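/- Let $I=[a,b]\subset\mathbb R$ be a compact interval. For a map $F:I\to I$, a *fort* of $F$ is a point of $(a,b)$ having no neighbourhood on which $F$ is strictly monotone, and $N(F)$ is the number of forts. $F$ is a *PM function*, $F\in\mathcal{PM}(I,I)$, if it is continuous and $N(F)<\infty$. Its forts are then written $c_1<\dots<c_v$, with $c_0:=a$ and $c_{v+1}:=b$, and the intervals $[c_i,c_{i+1}]$, $0\le i\le v$, are its *laps*. Writing $F^i$ for the $i$-th iterate ($F^0=\mathrm{id}$), the *height* $H(F)$ is the smallest integer $i\ge 0$ with $N(F^i)=N(F^{i+1})$, and $H(F)=\infty$ if there is none. If a lap contains $F(I)$, it is called the *characteristic interval* $K(F)$. A strictly increasing continuous map $\phi:[\alpha,\beta]\to[\alpha,\beta]$ with fixed point set $\mathrm{Fix}\,\phi$ is *reversing-correspondence* on $[\alpha,\beta]$ if (i) there are a point $\xi\in\mathrm{Fix}\,\phi$ and a strictly decreasing map $\omega$ of $\mathrm{Fix}\,\phi$ onto itself with $\omega(\xi)=\xi$, such that moreover (iii) below holds; (ii) $\alpha$ and $\beta$ either both belong to $\mathrm{Fix}\,\phi$ or both do not; (iii)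 for every pair of consecutive fixed points $\xi_1<\xi_2\le\xi$ and all $x\in(\xi_1,\xi_2)$, $y\in(\omega(\xi_2),\omega(\xi_1))$, one has $(\phi(x)-x)(\phi(y)-y)<0$. **Theorem.** Let $F\in\mathcal{PM}(I,I)$ have at least two forts ($v\ge 2$), with $H(F)=1$ and $K(F)=[c_0,c_1]$, and let $F$ be strictly increasing on $[c_0,c_1]$. Suppose that $F$ is reversing-correspondence on $[c_0,c_1]$ and that $$F(c_0)>c_0,\qquad F(c_1)<c_1,\qquad F(c_2)=c_0 .$$ Then there is $f\in\mathcal{PM}(I,I)$ (in particular, $f:I\to I$ is continuous) such that $f(f(x))=F(x)$ for all $x\in I$, $H(f)=2$, and $f$ is strictly decreasing on $[c_0,c_1]$. -/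

import Mathlib

open Set Filter Topology

namespace PMFun

/-- The forts (non-monotone points) of `F` on `I = [a, b]`: the interior points of `I` having no
neighbourhood on which `F` is strictly monotone. -/
def forts (a b : ℝ) (F : ℝ → ℝ) : Set ℝ :=
  {x | x ∈ Ioo a b ∧ ¬ ∃ U ∈ 𝓝 x, StrictMonoOn F U ∨ StrictAntiOn F U}

/-- The number `N(F)` of forts of `F` on `[a, b]`. -/
noncomputable def numForts (a b : ℝ) (F : ℝ → ℝ) : ℕ∞ := (forts a b F).encard

/-- `F` restricts to a piecewise monotone function of `[a, b]` into itself: a continuous self-map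
with finitely many forts. Values of `F` outside `[a, b]` play no role. -/
structure IsPM (a b : ℝ) (F : ℝ → ℝ) : Prop where
  continuousOn : ContinuousOn F (Icc a b)
  mapsTo : MapsTo F (Icc a b) (Icc a b)
  finite_forts : (forts a b F).Finite

/-- The nonmonotonicity height `H(F)`: the least `i` with `N(F^i) = N(F^(i+1))`, and `⊤` if there
is no such `i` (the infimum of the empty set in `ℕ∞` is `⊤`). -/
noncomputable def height (a b : ℝ) (F : ℝ → ℝ) : ℕ∞ :=
  sInf ((fun i : ℕ => (i : ℕ∞)) '' {i : ℕ | numForts a b F^[i] = numForts a b F^[i + 1]})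

/-- `a = c 0 < c 1 < ⋯ < c v < c (v + 1) = b`, where `c 1, …, c v` are exactly the forts of `F` on
`[a, b]`. Values `c i` with `i > v + 1` play no role. -/
structure IsFortEnum (a b : ℝ) (F : ℝ → ℝ) (v : ℕ) (c : ℕ → ℝ) : Prop where
  left : c 0 = a
  right : c (v + 1) = b
  strictMonoOn : StrictMonoOn c (Iic (v + 1))
  forts_eq : forts a b F = c '' Icc 1 v

/-- `[α, β]` is a lap of `F` on `[a, b]`: `α < β` are consecutive points of the set formed by
`a`, `b` and the forts of `F`. -/
structure IsLap (a b : ℝ) (F : ℝ → ℝ) (α β : ℝ) : Prop where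
  lt : α < β
  left_mem : α ∈ insert a (insert b (forts a b F))
  right_mem : β ∈ insert a (insert b (forts a b F))
  consecutive : ∀ z ∈ Ioo α β, z ∉ insert a (insert b (forts a b F))

/-- `K(F) = [α, β]`: the lap `[α, β]` of `F` covers the range of `F` on `[a, b]`. -/
structure IsCharInterval (a b : ℝ) (F : ℝ → ℝ) (α β : ℝ) : Prop where
  isLap : IsLap a b F α β
  range_subset : F '' Icc a b ⊆ Icc α β

/-- The fixed points of `φ` in `[α, β]`. -/
def fixPts (α β : ℝ) (φ : ℝ → ℝ) : Set ℝ := {x | x ∈ Icc α β ∧ φ x = x}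

/-- `φ` is reversing-correspondence on `[α, β]`. -/
structure IsReversingCorrespondence (α β : ℝ) (φ : ℝ → ℝ) : Prop where
  strictMonoOn : StrictMonoOn φ (Icc α β)
  continuousOn : ContinuousOn φ (Icc α β)
  mapsTo : MapsTo φ (Icc α β) (Icc α β)
  exists_reversal : ∃ ξ ∈ fixPts α β φ, ∃ ω : ℝ → ℝ,
    StrictAntiOn ω (fixPts α β φ) ∧ ω '' fixPts α β φ = fixPts α β φ ∧ ω ξ = ξ ∧
    (α ∈ fixPts α β φ ↔ β ∈ fixPts α β φ) ∧
    ∀ ξ₁ ∈ fixPts α β φ, ∀ ξ₂ ∈ fixPts α β φ, ξ₁ < ξ₂ → ξ₂ ≤ ξ →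
      (∀ z ∈ Ioo ξ₁ ξ₂, z ∉ fixPts α β φ) →
      ∀ x ∈ Ioo ξ₁ ξ₂, ∀ y ∈ Ioo (ω ξ₂) (ω ξ₁), (φ x - x) * (φ y - y) < 0

/-- `f` is a continuous iterative root of order `n` of `F` on `[a, b]`. -/
structure IsIterativeRoot (a b : ℝ) (n : ℕ) (F f : ℝ → ℝ) : Prop where
  continuousOn : ContinuousOn f (Icc a b)
  mapsTo : MapsTo f (Icc a b) (Icc a b)
  iterate_eq : EqOn f^[n] F (Icc a b)

end PMFun

/-! The increasing lap is handled first. `F` on `[c 0, c 1]` extends to a homeomorphism `G` of the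
line with the same fixed points. Between consecutive fixed points, orbits of `G` move one way, and
in the `ω`-mirrored gap they move the opposite way. Following the two orbit curves at equal times
therefore gives an order-reversing correspondence that commutes with `G`. Crossing from right to
left by it, and from left to right by it followed by `G`, is a decreasing square root `r`
(`IsMirrorSystem.exists_strictAnti_sqrt`). All fixed points lie strictly inside `(c 0, c 1)`, so `c
0` and `c 1` can be chosen as base points of the mirrored outer curves, which forces `r (c 1) = c
0`.

The root is `r` on `[c 0, c 1]`, `r⁻¹ ∘ F` on `[c 1, c 2]` and `Q⁻¹ ∘ r ∘ F` on `[c 2, b]`, where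
`Q` extends `F` from `[c 1, c 2]` (`exists_root_extension`). The pieces fit because `r (c 1) = c 0 =
F (c 2)`. The middle piece is increasing and the last is an increasing function of `F`, so exactly
the fort `c 2` disappears: `N(f) = N(F) - 1`, while `f²` and `f³` have the forts of `F`. -/

namespace PMFun

/-! ### Orbit curves of an increasing homeomorphism -/

/-- The curve through the `G`-orbit of `x`, affine between `x` and `G x` and equivariant under
`t ↦ t + 1`. -/
noncomputable def orbitCurve (G : ℝ ≃o ℝ) (x t : ℝ) : ℝ :=
  (G ^ ⌊t⌋) (x + Int.fract t * (G x - x))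

section orbitCurve

variable {G : ℝ ≃o ℝ} {x z : ℝ}

theorem zpow_add_one_apply (G : ℝ ≃o ℝ) (n : ℤ) (x : ℝ) : (G ^ (n + 1)) x = G ((G ^ n) x) := by
  rw [add_comm, zpow_add, zpow_one]; rfl

theorem zpow_add_one_apply' (G : ℝ ≃o ℝ) (n : ℤ) (x : ℝ) : (G ^ (n + 1)) x = (G ^ n) (G x) := by
  rw [zpow_add, zpow_one]; rfl

theorem zpow_apply_of_fixed (hz : G z = z) (n : ℤ) : (G ^ n) z = z := by
  induction n with
  | zero => rfl
  | succ n ih => rw [zpow_add_one_apply', hz, ih]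
  | pred n ih =>
    apply G.injective
    rw [← zpow_add_one_apply, sub_add_cancel, ih, hz]

theorem orbitCurve_zero (G : ℝ ≃o ℝ) (x : ℝ) : orbitCurve G x 0 = x := by
  simp [orbitCurve]

theorem orbitCurve_add_one (G : ℝ ≃o ℝ) (x t : ℝ) :
    orbitCurve G x (t + 1) = G (orbitCurve G x t) := by
  simp only [orbitCurve, Int.floor_add_one, Int.fract_add_one, zpow_add_one_apply]

theorem orbitCurve_of_fixed (hx : G x = x) (t : ℝ) : orbitCurve G x t = x := by
  simp [orbitCurve, hx, zpow_apply_of_fixed hx]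

/-- Both `x` and `G x` lie below `z`, hence so does the segment joining them, and every power of `G`
preserves this. -/
theorem orbitCurve_lt_fixed (hz : G z = z) (h : x < z) (t : ℝ) : orbitCurve G x t < z := by
  have h' : G x < z := hz ▸ G.strictMono h
  rw [← zpow_apply_of_fixed hz ⌊t⌋]
  refine (G ^ ⌊t⌋).strictMono ?_
  nlinarith [Int.fract_nonneg t, Int.fract_lt_one t]

theorem fixed_lt_orbitCurve (hz : G z = z) (h : z < x) (t : ℝ) : z < orbitCurve G x t := by
  have h' : z < G x := hz ▸ G.strictMono h
  rw [← zpow_apply_of_fixed hz ⌊t⌋]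
  refine (G ^ ⌊t⌋).strictMono ?_
  nlinarith [Int.fract_nonneg t, Int.fract_lt_one t]

theorem orbitCurve_le_fixed (hz : G z = z) (h : x ≤ z) (t : ℝ) : orbitCurve G x t ≤ z := by
  rcases h.eq_or_lt with rfl | h
  · exact (orbitCurve_of_fixed hz t).le
  · exact (orbitCurve_lt_fixed hz h t).le

theorem fixed_le_orbitCurve (hz : G z = z) (h : z ≤ x) (t : ℝ) : z ≤ orbitCurve G x t := by
  rcases h.eq_or_lt with rfl | h
  · exact (orbitCurve_of_fixed hz t).ge
  · exact (fixed_lt_orbitCurve hz h t).le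

theorem monotone_zpow_apply (hx : x ≤ G x) : Monotone fun n : ℤ => (G ^ n) x :=
  monotone_int_of_le_succ fun n => by
    rw [zpow_add_one_apply']; exact (G ^ n).monotone hx

theorem antitone_zpow_apply (hx : G x ≤ x) : Antitone fun n : ℤ => (G ^ n) x :=
  antitone_int_of_succ_le fun n => by
    rw [zpow_add_one_apply']; exact (G ^ n).monotone hx

theorem orbitCurve_strictMono (hx : x < G x) : StrictMono (orbitCurve G x) := by
  intro t s hts
  rcases (Int.floor_mono hts.le).eq_or_lt with h | h
  · simp only [orbitCurve, h]
    refine (G ^ ⌊s⌋).strictMono ?_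
    have : Int.fract t < Int.fract s := by
      simp only [Int.fract, h]; linarith
    nlinarith
  · calc orbitCurve G x t < (G ^ ⌊t⌋) (G x) :=
          (G ^ ⌊t⌋).strictMono (by nlinarith [Int.fract_lt_one t])
      _ = (G ^ (⌊t⌋ + 1)) x := (zpow_add_one_apply' ..).symm
      _ ≤ (G ^ ⌊s⌋) x := monotone_zpow_apply hx.le h
      _ ≤ orbitCurve G x s := (G ^ ⌊s⌋).monotone (by nlinarith [Int.fract_nonneg s])

theorem orbitCurve_strictAnti (hx : G x < x) : StrictAnti (orbitCurve G x) := by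
  intro t s hts
  rcases (Int.floor_mono hts.le).eq_or_lt with h | h
  · simp only [orbitCurve, h]
    refine (G ^ ⌊s⌋).strictMono ?_
    have : Int.fract t < Int.fract s := by
      simp only [Int.fract, h]; linarith
    nlinarith
  · calc orbitCurve G x s ≤ (G ^ ⌊s⌋) x :=
          (G ^ ⌊s⌋).monotone (by nlinarith [Int.fract_nonneg s])
      _ ≤ (G ^ (⌊t⌋ + 1)) x := antitone_zpow_apply hx.le h
      _ = (G ^ ⌊t⌋) (G x) := zpow_add_one_apply' ..
      _ < orbitCurve G x t := (G ^ ⌊t⌋).strictMono (by nlinarith [Int.fract_lt_one t])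

/-- A monotone orbit bounded by `y` accumulates at a fixed point. -/
theorem exists_fixed_of_forall_pow_le {y : ℝ} (hx : x ≤ G x) (h : ∀ n : ℕ, (G ^ n) x ≤ y) :
    ∃ z ∈ Icc x y, G z = z := by
  have hm : Monotone fun n : ℕ => (G ^ n) x := monotone_nat_of_le_succ fun n => by
    rw [pow_succ]; exact (G ^ n).monotone hx
  have hlim := tendsto_atTop_ciSup hm ⟨y, by rintro _ ⟨n, rfl⟩; exact h n⟩
  refine ⟨_, ⟨ge_of_tendsto' hlim fun n => hm (Nat.zero_le n), le_of_tendsto' hlim h⟩, ?_⟩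
  refine tendsto_nhds_unique ((G.continuous.tendsto _).comp hlim) ?_
  convert (tendsto_add_atTop_iff_nat 1).2 hlim using 2 with n
  rw [pow_succ']; rfl

theorem exists_fixed_of_forall_le_pow {y : ℝ} (hx : G x ≤ x) (h : ∀ n : ℕ, y ≤ (G ^ n) x) :
    ∃ z ∈ Icc y x, G z = z := by
  have hm : Antitone fun n : ℕ => (G ^ n) x := antitone_nat_of_succ_le fun n => by
    rw [pow_succ]; exact (G ^ n).monotone hx
  have hlim := tendsto_atTop_ciInf hm ⟨y, by rintro _ ⟨n, rfl⟩; exact h n⟩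
  refine ⟨_, ⟨ge_of_tendsto' hlim h, le_of_tendsto' hlim fun n => hm (Nat.zero_le n)⟩, ?_⟩
  refine tendsto_nhds_unique ((G.continuous.tendsto _).comp hlim) ?_
  convert (tendsto_add_atTop_iff_nat 1).2 hlim using 2 with n
  rw [pow_succ']; rfl

theorem exists_lt_pow {y : ℝ} (hx : x ≤ G x) (h : ∀ z ∈ uIcc x y, G z ≠ z) :
    ∃ n : ℕ, y < (G ^ n) x := by
  by_contra! hc
  obtain ⟨z, hz, hz'⟩ := exists_fixed_of_forall_pow_le hx hc
  exact h z (Icc_subset_uIcc hz) hz'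

theorem exists_pow_lt {y : ℝ} (hx : G x ≤ x) (h : ∀ z ∈ uIcc x y, G z ≠ z) :
    ∃ n : ℕ, (G ^ n) x < y := by
  by_contra! hc
  obtain ⟨z, hz, hz'⟩ := exists_fixed_of_forall_le_pow hx hc
  exact h z (Icc_subset_uIcc' hz) hz'

theorem inv_apply_eq_self_iff : G⁻¹ z = z ↔ G z = z :=
  ⟨fun h => by conv_lhs => rw [← h]
               exact G.apply_symm_apply z,
   fun h => by conv_lhs => rw [← h]
               exact G.symm_apply_apply z⟩

theorem inv_pow_apply (G : ℝ ≃o ℝ) (n : ℕ) (x : ℝ) : (G⁻¹ ^ n) x = (G ^ (-n : ℤ)) x := by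
  rw [zpow_neg, zpow_natCast, inv_pow]

/-- If no fixed point separates `x` from `y`, the orbit curve of `x` passes through `y`. -/
theorem exists_orbitCurve_eq {y : ℝ} (h : ∀ z ∈ uIcc x y, G z ≠ z) :
    ∃ t, orbitCurve G x t = y := by
  have h' : ∀ z ∈ uIcc x y, G⁻¹ z ≠ z := fun z hz hz' => h z hz (inv_apply_eq_self_iff.1 hz')
  suffices ∃ n : ℤ, ∃ s : ℝ, 0 ≤ s ∧ s < 1 ∧ (G ^ n) (x + s * (G x - x)) = y by
    obtain ⟨n, s, h0, h1, hs⟩ := this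
    refine ⟨n + s, ?_⟩
    have hf : ⌊(n + s : ℝ)⌋ = n := by
      rw [Int.floor_intCast_add, Int.floor_eq_zero_iff.2 ⟨h0, h1⟩, add_zero]
    have hfr : Int.fract (n + s : ℝ) = s := by
      rw [Int.fract_intCast_add, Int.fract_eq_self.2 ⟨h0, h1⟩]
    rw [orbitCurve, hf, hfr, hs]
  rcases lt_trichotomy x (G x) with hx | hx | hx
  · have hxi : G⁻¹ x ≤ x := (G.symm_apply_le).2 hx.le
    obtain ⟨k, hk⟩ := exists_lt_pow hx.le h
    obtain ⟨m, hm⟩ := exists_pow_lt hxi h'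
    rw [inv_pow_apply] at hm
    have hmono := monotone_zpow_apply hx.le
    -- The last `n` at which the orbit has not passed `y`; pulling `y` back by `G ^ n` puts it in
    -- `[x, G x)`, where the curve is affine.
    obtain ⟨n, hn, hmax⟩ := Int.exists_greatest_of_bdd (P := fun n => (G ^ n) x ≤ y)
      ⟨k, fun z hz => by
        by_contra! hkz
        have : (G ^ (k : ℤ)) x ≤ (G ^ z) x := hmono hkz.le
        rw [zpow_natCast] at this
        linarith⟩ ⟨_, hm.le⟩
    have hn1 : y < (G ^ n) (G x) := by
      rw [← zpow_add_one_apply']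
      by_contra! hc
      linarith [hmax _ hc]
    have hw1 : x ≤ (G ^ n).symm y := (G ^ n).le_symm_apply.2 hn
    have hw2 : (G ^ n).symm y < G x := (G ^ n).symm_apply_lt.2 hn1
    have hd : 0 < G x - x := sub_pos.2 hx
    refine ⟨n, ((G ^ n).symm y - x) / (G x - x), div_nonneg (by linarith) hd.le,
      (div_lt_one hd).2 (by linarith), ?_⟩
    rw [div_mul_cancel₀ _ hd.ne', add_sub_cancel, OrderIso.apply_symm_apply]
  · exact absurd hx.symm (h x left_mem_uIcc)
  · have hxi : x ≤ G⁻¹ x := (G.le_symm_apply).2 hx.le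
    obtain ⟨k, hk⟩ := exists_pow_lt hx.le h
    obtain ⟨m, hm⟩ := exists_lt_pow hxi h'
    rw [inv_pow_apply] at hm
    have hanti := antitone_zpow_apply hx.le
    obtain ⟨n, hn, hmax⟩ := Int.exists_greatest_of_bdd (P := fun n => y ≤ (G ^ n) x)
      ⟨k, fun z hz => by
        by_contra! hkz
        have : (G ^ z) x ≤ (G ^ (k : ℤ)) x := hanti hkz.le
        rw [zpow_natCast] at this
        linarith⟩ ⟨_, hm.le⟩
    have hn1 : (G ^ n) (G x) < y := by
      rw [← zpow_add_one_apply']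
      by_contra! hc
      linarith [hmax _ hc]
    have hw1 : (G ^ n).symm y ≤ x := (G ^ n).symm_apply_le.2 hn
    have hw2 : G x < (G ^ n).symm y := (G ^ n).lt_symm_apply.2 hn1
    have hd : G x - x < 0 := sub_neg.2 hx
    refine ⟨n, ((G ^ n).symm y - x) / (G x - x), div_nonneg_of_nonpos (by linarith) hd.le,
      (div_lt_one_of_neg hd).2 (by linarith), ?_⟩
    rw [div_mul_cancel₀ _ hd.ne, add_sub_cancel, OrderIso.apply_symm_apply]

end orbitCurve

/-! ### Mirror systems and the decreasing square root -/

/-- The points `x` and `y` lie at the same parameter on the orbit curves of a pair from `S`. -/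
def mirrorRel (G : ℝ ≃o ℝ) (S : Set (ℝ × ℝ)) (x y : ℝ) : Prop :=
  ∃ p ∈ S, ∃ t, orbitCurve G p.1 t = x ∧ orbitCurve G p.2 t = y

/-- The pair `p` lies to the left of `q` in the first, and to the right of it in the second
coordinate, and fixed points of `G` separate them in both. -/
def Separated (G : ℝ ≃o ℝ) (p q : ℝ × ℝ) : Prop :=
  (p.1 < q.1 ∧ q.2 < p.2) ∧ (∃ z, G z = z ∧ p.1 ≤ z ∧ z ≤ q.1) ∧ ∃ z, G z = z ∧ q.2 ≤ z ∧ z ≤ p.2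

/-- Base pairs whose orbit curves move in opposite directions and which are separated from each
other by fixed points of `G`. -/
structure IsMirrorSystem (G : ℝ ≃o ℝ) (S : Set (ℝ × ℝ)) : Prop where
  opposite : ∀ p ∈ S, (G p.1 = p.1 ∧ G p.2 = p.2) ∨ (p.1 < G p.1 ∧ G p.2 < p.2) ∨
    (G p.1 < p.1 ∧ p.2 < G p.2)
  separated : ∀ p ∈ S, ∀ q ∈ S, p = q ∨ Separated G p q ∨ Separated G q p

section mirror

variable {G : ℝ ≃o ℝ} {S : Set (ℝ × ℝ)} {x y x' y' : ℝ}

theorem mirrorRel.map (h : mirrorRel G S x y) : mirrorRel G S (G x) (G y) := by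
  obtain ⟨p, hp, t, rfl, rfl⟩ := h
  exact ⟨p, hp, t + 1, orbitCurve_add_one .., orbitCurve_add_one ..⟩

/-- Orbit curves never cross a fixed point. Strictness survives because the base points differ, so
at most one of them is the separating fixed point. -/
theorem Separated.orbitCurve_lt {p q : ℝ × ℝ} (h : Separated G p q) (t s : ℝ) :
    orbitCurve G p.1 t < orbitCurve G q.1 s ∧ orbitCurve G q.2 s < orbitCurve G p.2 t := by
  obtain ⟨⟨h1, h2⟩, ⟨z, hz, hpz, hzq⟩, w, hw, hqw, hwp⟩ := h
  constructor
  · rcases hpz.lt_or_eq with h | h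
    · exact (orbitCurve_lt_fixed hz h t).trans_le (fixed_le_orbitCurve hz hzq s)
    · exact (orbitCurve_le_fixed hz hpz t).trans_lt (fixed_lt_orbitCurve hz (h ▸ h1) s)
  · rcases hqw.lt_or_eq with h | h
    · exact (orbitCurve_lt_fixed hw h s).trans_le (fixed_le_orbitCurve hw hwp t)
    · exact (orbitCurve_le_fixed hw hqw s).trans_lt (fixed_lt_orbitCurve hw (h ▸ h2) t)

/-- On one pair the two curves run in opposite directions; across different pairs the separation
decides. So the relation is the graph of a decreasing partial injection. -/
theorem IsMirrorSystem.lt_iff (hS : IsMirrorSystem G S) (h : mirrorRel G S x y)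
    (h' : mirrorRel G S x' y') : x < x' ↔ y' < y := by
  obtain ⟨p, hp, t, rfl, rfl⟩ := h
  obtain ⟨q, hq, s, rfl, rfl⟩ := h'
  rcases hS.separated p hp q hq with rfl | h | h
  · rcases hS.opposite p hp with ⟨h1, h2⟩ | ⟨h1, h2⟩ | ⟨h1, h2⟩
    · simp only [orbitCurve_of_fixed h1, orbitCurve_of_fixed h2, lt_irrefl]
    · rw [(orbitCurve_strictMono h1).lt_iff_lt, (orbitCurve_strictAnti h2).lt_iff_gt]
    · rw [(orbitCurve_strictAnti h1).lt_iff_gt, (orbitCurve_strictMono h2).lt_iff_lt]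
  · exact iff_of_true (h.orbitCurve_lt t s).1 (h.orbitCurve_lt t s).2
  · exact iff_of_false (h.orbitCurve_lt s t).1.not_gt (h.orbitCurve_lt s t).2.not_gt

theorem IsMirrorSystem.eq_iff (hS : IsMirrorSystem G S) (h : mirrorRel G S x y)
    (h' : mirrorRel G S x' y') : x = x' ↔ y = y' := by
  have h1 := hS.lt_iff h h'
  have h2 := hS.lt_iff h' h
  constructor <;> intro he <;> subst he
  · exact le_antisymm (by simpa using h1) (by simpa using h2)
  · exact le_antisymm (by simpa using h2) (by simpa using h1)

/-- A mirror system matching the two sides of a fixed point yields a decreasing square root. -/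
theorem IsMirrorSystem.exists_strictAnti_sqrt (hS : IsMirrorSystem G S) {ξ : ℝ} (hξ : G ξ = ξ)
    (hξξ : mirrorRel G S ξ ξ) (hl : ∀ x ≤ ξ, ∃ y, mirrorRel G S x y)
    (hr : ∀ y, ξ ≤ y → ∃ x, mirrorRel G S x y) :
    ∃ φ : ℝ → ℝ, StrictAnti φ ∧ (∀ x, φ (φ x) = G x) ∧
      ∀ x y, mirrorRel G S x y → ξ ≤ y → φ y = x := by
  choose! R hR using hl
  choose! L hL using hr
  have hle {x y} (h : mirrorRel G S x y) : x ≤ ξ ↔ ξ ≤ y := by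
    rw [← not_lt, ← not_lt, hS.lt_iff hξξ h]
  have hlt {x y} (h : mirrorRel G S x y) : x < ξ ↔ ξ < y := hS.lt_iff h hξξ
  classical
  -- Only one of the two crossings carries the factor `G`, so a round trip applies `G` exactly once.
  set φ : ℝ → ℝ := fun y => if ξ ≤ y then L y else G (R y) with hφ
  have hφr {y} (hy : ξ ≤ y) : φ y = L y := if_pos hy
  have hφl {y} (hy : y < ξ) : φ y = G (R y) := if_neg hy.not_ge
  have hφL (x y) (h : mirrorRel G S x y) (hy : ξ ≤ y) : φ y = x := by
    rw [hφr hy]; exact (hS.eq_iff (hL y hy) h).2 rfl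
  have hφR (x y) (h : mirrorRel G S x y) (hx : x < ξ) : φ x = G y := by
    rw [hφl hx]; exact congrArg G ((hS.eq_iff (hR x hx.le) h).1 rfl)
  refine ⟨φ, fun y y' hyy => ?_, fun y => ?_, hφL⟩
  · rcases lt_or_ge y' ξ with h' | h'
    · have h := hyy.trans h'
      rw [hφl h, hφl h', G.lt_iff_lt]
      exact (hS.lt_iff (hR y h.le) (hR y' h'.le)).1 hyy
    · have hy' : φ y' ≤ ξ := by rw [hφr h']; exact (hle (hL y' h')).2 h'
      rcases lt_or_ge y ξ with h | h
      · refine hy'.trans_lt ?_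
        rw [hφl h, ← hξ, G.lt_iff_lt]
        simpa [hξ] using (hlt (hR y h.le)).1 h
      · rw [hφr h, hφr h']
        exact (hS.lt_iff (hL y' h') (hL y h)).2 hyy
  · rcases lt_or_ge y ξ with h | h
    · rw [hφR _ _ (hR y h.le) h]
      refine hφL _ _ (hR y h.le).map ?_
      rw [← hξ]
      exact G.monotone ((hle (hR y h.le)).1 h.le)
    · rw [hφL _ _ (hL y h) h]
      rcases h.eq_or_lt with rfl | h'
      · have : L ξ = ξ := (hS.eq_iff (hL ξ le_rfl) hξξ).2 rfl
        rw [this, hφL _ _ hξξ le_rfl, hξ]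
      · exact hφR _ _ (hL y h) ((hlt (hL y h)).2 h')

end mirror

/-! ### Gaps between fixed points and their mirror images -/

/-- `l ≤ u` are equal or consecutive fixed points of `G`. -/
structure IsFixedGap (G : ℝ ≃o ℝ) (l u : ℝ) : Prop where
  le : l ≤ u
  left : G l = l
  right : G u = u
  gap : ∀ z ∈ Ioo l u, G z ≠ z

/-- The centres of the fixed gaps left of `ξ`, each paired with the centre of its mirror image
under `ω`, together with the extra pair `(p, q)`. -/
def mirrorPairs (G : ℝ ≃o ℝ) (ω : ℝ → ℝ) (ξ p q : ℝ) : Set (ℝ × ℝ) :=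
  insert (p, q) {r | ∃ l u, IsFixedGap G l u ∧ u ≤ ξ ∧ r = ((l + u) / 2, (ω l + ω u) / 2)}

section fixedGap

variable {G : ℝ ≃o ℝ} {l u l' u' ξ p q x : ℝ} {ω : ℝ → ℝ}

theorem isClosed_fixed (G : ℝ ≃o ℝ) : IsClosed {z | G z = z} :=
  isClosed_eq G.continuous continuous_id

/-- The strict inequalities matter for degenerate gaps: they keep the midpoints distinct. -/
theorem IsFixedGap.trichotomy (h : IsFixedGap G l u) (h' : IsFixedGap G l' u') :
    (l = l' ∧ u = u') ∨ (u ≤ l' ∧ l < u') ∨ (u' ≤ l ∧ l' < u) := by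
  have key {l u l' u'} (h : IsFixedGap G l u) (h' : IsFixedGap G l' u') (hl : l < l') : u ≤ l' := by
    by_contra! hc
    exact h.gap l' ⟨hl, hc⟩ h'.left
  have := h.le
  have := h'.le
  rcases lt_trichotomy l l' with hl | hl | hl
  · exact .inr (.inl ⟨key h h' hl, by linarith⟩)
  · subst hl
    rcases lt_trichotomy u u' with hu | hu | hu
    · refine .inr (.inl ⟨?_, by linarith⟩)
      by_contra! hc
      exact h'.gap u ⟨hc, hu⟩ h.right
    · exact .inl ⟨rfl, hu⟩
    · refine .inr (.inr ⟨?_, by linarith⟩)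
      by_contra! hc
      exact h.gap u' ⟨hc, hu⟩ h'.right
  · exact .inr (.inr ⟨key h' h hl, by linarith⟩)

/-- The fixed point set is closed, so there are a nearest fixed point below `x` and one above. -/
theorem exists_isFixedGap (hx : G x ≠ x) {s t : ℝ} (hs : G s = s) (ht : G t = t) (hsx : s ≤ x)
    (hxt : x ≤ t) : ∃ l u, IsFixedGap G l u ∧ s ≤ l ∧ l < x ∧ x < u ∧ u ≤ t := by
  obtain ⟨l, ⟨⟨hsl, hlx⟩, hl⟩, hlmax⟩ := (isCompact_Icc.inter_right (isClosed_fixed G)).exists_isGreatest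
    (⟨s, ⟨le_rfl, hsx⟩, hs⟩ : (Icc s x ∩ {z | G z = z}).Nonempty)
  obtain ⟨u, ⟨⟨hxu, hut⟩, hu⟩, humin⟩ := (isCompact_Icc.inter_right (isClosed_fixed G)).exists_isLeast
    (⟨t, ⟨hxt, le_rfl⟩, ht⟩ : (Icc x t ∩ {z | G z = z}).Nonempty)
  refine ⟨l, u, ⟨hlx.trans hxu, hl, hu, fun z hz hzf => ?_⟩, hsl,
    hlx.lt_of_ne (by rintro rfl; exact hx hl), hxu.lt_of_ne (by rintro rfl; exact hx hu), hut⟩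
  rcases le_total z x with h | h
  · exact (hlmax ⟨⟨hsl.trans hz.1.le, h⟩, hzf⟩).not_gt hz.1
  · exact (humin ⟨⟨h, hz.2.le.trans hut⟩, hzf⟩).not_gt hz.2

theorem IsFixedGap.exists_orbitCurve_eq (h : IsFixedGap G l u) (hx : x ∈ Ioo l u) :
    ∃ t, orbitCurve G ((l + u) / 2) t = x := by
  have hm : (l + u) / 2 ∈ Ioo l u := ⟨by linarith [hx.1, hx.2], by linarith [hx.1, hx.2]⟩
  exact PMFun.exists_orbitCurve_eq fun z hz => h.gap z (OrdConnected.uIcc_subset inferInstance hm hx hz)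

theorem IsFixedGap.mirror
    (hanti : StrictAntiOn ω {z | G z = z}) (hω : ω '' {z | G z = z} = {z | G z = z})
    (h : IsFixedGap G l u) :
    IsFixedGap G (ω u) (ω l) where
  le := hanti.antitoneOn h.left h.right h.le
  left := (hω ▸ mem_image_of_mem ω h.right : ω u ∈ {z | G z = z})
  right := (hω ▸ mem_image_of_mem ω h.left : ω l ∈ {z | G z = z})
  gap := by
    rintro w ⟨h1, h2⟩ hw
    obtain ⟨z, hz, rfl⟩ : w ∈ ω '' {z | G z = z} := hω.ge hw
    exact h.gap z ⟨(hanti.lt_iff_gt hz h.left).1 h2, (hanti.lt_iff_gt h.right hz).1 h1⟩ hz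

theorem IsFixedGap.exists_mirror
    (hanti : StrictAntiOn ω {z | G z = z}) (hω : ω '' {z | G z = z} = {z | G z = z})
    (h : IsFixedGap G l u) :
    ∃ l' u', IsFixedGap G l' u' ∧ ω l' = u ∧ ω u' = l := by
  obtain ⟨l', hl', rfl⟩ : u ∈ ω '' {z | G z = z} := hω.ge h.right
  obtain ⟨u', hu', rfl⟩ : l ∈ ω '' {z | G z = z} := hω.ge h.left
  refine ⟨l', u', ⟨(hanti.le_iff_ge hu' hl').1 h.le, hl', hu', fun z hz hzf => ?_⟩, rfl, rfl⟩
  exact h.gap (ω z) ⟨hanti hzf hu' hz.2, hanti hl' hzf hz.1⟩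
    (hω ▸ mem_image_of_mem ω hzf : ω z ∈ {z | G z = z})

theorem isMirrorSystem_mirrorPairs
    (hanti : StrictAntiOn ω {z | G z = z}) (hω : ω '' {z | G z = z} = {z | G z = z})
    (hbd : ∀ z, G z = z → p < z ∧ z < q) (hp : p < G p) (hq : G q < q)
    (hsign : ∀ l u, IsFixedGap G l u → l < u → u ≤ ξ → ∀ x ∈ Ioo l u, ∀ y ∈ Ioo (ω u) (ω l),
      (G x - x) * (G y - y) < 0) :
    IsMirrorSystem G (mirrorPairs G ω ξ p q) where
  opposite := by
    rintro r (rfl | ⟨l, u, h, hu, rfl⟩)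
    · exact .inr (.inl ⟨hp, hq⟩)
    · rcases h.le.eq_or_lt with rfl | hlt
      · simp only [add_self_div_two]
        exact .inl ⟨h.left, (h.mirror hanti hω).left⟩
      · have hlt' : ω u < ω l := hanti h.left h.right hlt
        rcases mul_neg_iff.1 (hsign l u h hlt hu ((l + u) / 2) ⟨by linarith, by linarith⟩
          ((ω l + ω u) / 2) ⟨by linarith, by linarith⟩) with ⟨h1, h2⟩ | ⟨h1, h2⟩
        · exact .inr (.inl ⟨by simpa using h1, by simpa using h2⟩)
        · exact .inr (.inr ⟨by simpa using h1, by simpa using h2⟩)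
  separated := by
    have hend {l u} (h : IsFixedGap G l u) :
        Separated G (p, q) ((l + u) / 2, (ω l + ω u) / 2) := by
      have h' := h.mirror hanti hω
      have := h.le
      have := h'.le
      have h1 := hbd l h.left
      have h2 := hbd _ h'.right
      refine ⟨⟨?_, ?_⟩, ⟨l, h.left, h1.1.le, ?_⟩, ω l, h'.right, ?_, h2.2.le⟩ <;> dsimp only <;>
        linarith
    have hgap {l u l' u'} (h : IsFixedGap G l u) (h' : IsFixedGap G l' u') (hul : u ≤ l')
        (hlu : l < u') : Separated G ((l + u) / 2, (ω l + ω u) / 2)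
          ((l' + u') / 2, (ω l' + ω u') / 2) := by
      have := h.le
      have := h'.le
      have h1 := hanti.antitoneOn h.right h'.left hul
      have h2 := hanti h.left h'.right hlu
      have := (h.mirror hanti hω).le
      have := (h'.mirror hanti hω).le
      refine ⟨⟨?_, ?_⟩, ⟨u, h.right, ?_, ?_⟩, ω u, (h.mirror hanti hω).left, ?_, ?_⟩ <;>
        dsimp only <;> linarith
    rintro r (rfl | ⟨l, u, h, hu, rfl⟩) r' (rfl | ⟨l', u', h', hu', rfl⟩)
    · exact .inl rfl
    · exact .inr (.inl (hend h'))
    · exact .inr (.inr (hend h))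
    · rcases h.trichotomy h' with ⟨rfl, rfl⟩ | ⟨h1, h2⟩ | ⟨h1, h2⟩
      · exact .inl rfl
      · exact .inr (.inl (hgap h h' h1 h2))
      · exact .inr (.inr (hgap h' h h1 h2))

/-- An increasing homeomorphism whose fixed points admit a reversing correspondence has a decreasing
square root, and one can prescribe a value `φ q = p` outside the hull of the fixed points. -/
theorem exists_strictAnti_sqrt
    (hanti : StrictAntiOn ω {z | G z = z}) (hω : ω '' {z | G z = z} = {z | G z = z})
    (hξ : G ξ = ξ) (hωξ : ω ξ = ξ)
    (hbd : ∀ z, G z = z → p < z ∧ z < q) (hp : p < G p) (hq : G q < q)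
    (hsign : ∀ l u, IsFixedGap G l u → l < u → u ≤ ξ → ∀ x ∈ Ioo l u, ∀ y ∈ Ioo (ω u) (ω l),
      (G x - x) * (G y - y) < 0) :
    ∃ φ : ℝ → ℝ, StrictAnti φ ∧ (∀ x, φ (φ x) = G x) ∧ φ q = p := by
  have hS := isMirrorSystem_mirrorPairs hanti hω hbd hp hq hsign
  have hend (t) : mirrorRel G (mirrorPairs G ω ξ p q) (orbitCurve G p t) (orbitCurve G q t) :=
    ⟨(p, q), mem_insert .., t, rfl, rfl⟩
  have hgap {l u} (h : IsFixedGap G l u) (hu : u ≤ ξ) (t) : mirrorRel G (mirrorPairs G ω ξ p q)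
      (orbitCurve G ((l + u) / 2) t) (orbitCurve G ((ω l + ω u) / 2) t) :=
    ⟨_, mem_insert_of_mem _ ⟨l, u, h, hu, rfl⟩, t, rfl, rfl⟩
  -- A fixed point is a degenerate gap, equal to its own centre.
  have hfix {z} (hz : G z = z) (hzξ : z ≤ ξ) : mirrorRel G (mirrorPairs G ω ξ p q) z (ω z) := by
    have h := hgap (l := z) (u := z) ⟨le_rfl, hz, hz, fun w hw => (hw.1.trans hw.2).false.elim⟩ hzξ 0
    simpa only [add_self_div_two, orbitCurve_zero] using h
  have hl (x) (hx : x ≤ ξ) : ∃ y, mirrorRel G (mirrorPairs G ω ξ p q) x y := by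
    by_cases hxf : G x = x
    · exact ⟨_, hfix hxf hx⟩
    by_cases hs : ∃ s ≤ x, G s = s
    · obtain ⟨s, hsx, hs⟩ := hs
      obtain ⟨l, u, h, -, hlx, hxu, hu⟩ := exists_isFixedGap hxf hs hξ hsx hx
      obtain ⟨t, rfl⟩ := h.exists_orbitCurve_eq ⟨hlx, hxu⟩
      exact ⟨_, hgap h hu t⟩
    · push Not at hs
      -- Below all fixed points lies a single orbit curve, that of `p`.
      obtain ⟨t, rfl⟩ := exists_orbitCurve_eq (G := G) (x := p) (y := x) fun z hz hzf => by
        rcases le_max_iff.1 hz.2 with h | h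
        · exact h.not_gt (hbd z hzf).1
        · exact hs z h hzf
      exact ⟨_, hend t⟩
  have hr (y) (hy : ξ ≤ y) : ∃ x, mirrorRel G (mirrorPairs G ω ξ p q) x y := by
    by_cases hyf : G y = y
    · obtain ⟨x, hx, rfl⟩ : y ∈ ω '' {z | G z = z} := hω.ge hyf
      refine ⟨x, hfix hx ?_⟩
      rwa [← hωξ, hanti.le_iff_ge hξ hx] at hy
    by_cases hs : ∃ s, y ≤ s ∧ G s = s
    · obtain ⟨s, hsy, hs⟩ := hs
      obtain ⟨l, u, h, hl, hly, hyu, -⟩ := exists_isFixedGap hyf hξ hs hy hsy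
      obtain ⟨l', u', h', rfl, rfl⟩ := h.exists_mirror hanti hω
      have hu' : u' ≤ ξ := by rwa [← hωξ, hanti.le_iff_ge hξ h'.right] at hl
      obtain ⟨t, rfl⟩ := h.exists_orbitCurve_eq ⟨hly, hyu⟩
      rw [add_comm]
      exact ⟨_, hgap h' hu' t⟩
    · push Not at hs
      obtain ⟨t, rfl⟩ := exists_orbitCurve_eq (G := G) (x := q) (y := y) fun z hz hzf => by
        rcases min_le_iff.1 hz.1 with h | h
        · exact h.not_gt (hbd z hzf).2
        · exact hs z h hzf
      exact ⟨_, hend t⟩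
  obtain ⟨φ, hφ, hφφ, hφq⟩ :=
    hS.exists_strictAnti_sqrt hξ (by simpa [hωξ] using hfix hξ le_rfl) hl hr
  refine ⟨φ, hφ, hφφ, hφq p q ?_ (hbd ξ hξ).2.le⟩
  simpa only [orbitCurve_zero] using hend 0

end fixedGap

/-! ### Extension to the line and the root on the characteristic interval -/

/-- A strictly increasing continuous function on a compact interval extends to an increasing
homeomorphism of the line that is a translation on either side of the interval. -/
theorem exists_orderIso_extension {α β : ℝ} {F : ℝ → ℝ} (h : α ≤ β)
    (hm : StrictMonoOn F (Icc α β)) (hc : ContinuousOn F (Icc α β)) :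
    ∃ G : ℝ ≃o ℝ, EqOn G F (Icc α β) ∧ (∀ x ≤ α, G x = F α + (x - α)) ∧
      ∀ x, β ≤ x → G x = F β + (x - β) := by
  -- The retraction onto `[α, β]`; `x - π x` supplies the translations outside.
  set π : ℝ → ℝ := fun x => max α (min β x) with hπ
  have hmem (x) : π x ∈ Icc α β := ⟨le_max_left .., max_le h (min_le_left ..)⟩
  have hπmono : Monotone π := fun x y hxy => max_le_max le_rfl (min_le_min le_rfl hxy)
  have hFc : Continuous fun x => F (π x) :=
    hc.comp_continuous (by fun_prop) hmem
  have hlip {x y} (hxy : x ≤ y) : π y - π x ≤ y - x := by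
    simp only [hπ]
    rcases max_cases α (min β x) with h1 | h1 <;> rcases max_cases α (min β y) with h2 | h2 <;>
    rcases min_cases β x with h3 | h3 <;> rcases min_cases β y with h4 | h4 <;> linarith
  have hmono : StrictMono fun x => F (π x) + (x - π x) := by
    intro x y hxy
    have h1 := hlip hxy.le
    rcases (hπmono hxy.le).eq_or_lt with h2 | h2
    · simp only [h2]; linarith
    · have := hm (hmem x) (hmem y) h2
      dsimp only; linarith
  have hF (x) : F α ≤ F (π x) ∧ F (π x) ≤ F β :=
    ⟨hm.monotoneOn (left_mem_Icc.2 h) (hmem x) (hmem x).1,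
      hm.monotoneOn (hmem x) (right_mem_Icc.2 h) (hmem x).2⟩
  have hsurj : Function.Surjective fun x => F (π x) + (x - π x) := by
    refine Continuous.surjective (hFc.add (by fun_prop)) ?_ ?_
    · refine tendsto_atTop_mono (fun x => ?_) (tendsto_atTop_add_const_right atTop (F α - β) tendsto_id)
      have := hF x
      have := hmem x
      simp only [id, mem_Icc] at *; linarith
    · refine tendsto_atBot_mono (fun x => ?_) (tendsto_atBot_add_const_right atBot (F β - α) tendsto_id)
      have := hF x
      have := hmem x
      simp only [id, mem_Icc] at *; linarith
  refine ⟨hmono.orderIsoOfSurjective _ hsurj, fun x hx => ?_, fun x hx => ?_, fun x hx => ?_⟩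
  · have : π x = x := by simp [hπ, hx.1, hx.2]
    simp [this]
  · have : π x = α := by simp [hπ, hx]
    simp [this]
  · have : π x = β := by simp [hπ, hx, h]
    simp [this]

theorem IsReversingCorrespondence.exists_strictAnti_sqrt {α β : ℝ} {g : ℝ → ℝ}
    (h : IsReversingCorrespondence α β g) (h0 : α < g α) (h1 : g β < β) :
    ∃ r : ℝ → ℝ, StrictAnti r ∧ Function.Surjective r ∧ (∀ x ∈ Icc α β, r (r x) = g x) ∧
      r β = α := by
  obtain ⟨ξ, hξ, ω, hanti, hω, hωξ, -, hsign⟩ := h.exists_reversal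
  obtain ⟨G, hG, hGl, hGr⟩ :=
    exists_orderIso_extension (hξ.1.1.trans hξ.1.2) h.strictMonoOn h.continuousOn
  -- Outside, `G` is translation by `g α - α > 0` or `g β - β < 0`, which fixes nothing.
  have hbd (z) (hz : G z = z) : α < z ∧ z < β := by
    constructor
    · by_contra! hc
      linarith [hGl z hc]
    · by_contra! hc
      linarith [hGr z hc]
  have hfix : fixPts α β g = {z | G z = z} := by
    ext z
    constructor
    · rintro ⟨hz, hz'⟩
      rw [mem_ofPred_eq, hG hz, hz']
    · intro hz
      have hz' : z ∈ Icc α β := ⟨(hbd z hz).1.le, (hbd z hz).2.le⟩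
      exact ⟨hz', hG hz' ▸ hz⟩
  rw [hfix] at hanti hω hξ hsign
  have hαβ := (hbd ξ hξ).1.trans (hbd ξ hξ).2
  obtain ⟨r, hr, hrr, hrβ⟩ := PMFun.exists_strictAnti_sqrt (p := α) (q := β) hanti hω hξ hωξ hbd
    (by rwa [hG (left_mem_Icc.2 hαβ.le)]) (by rwa [hG (right_mem_Icc.2 hαβ.le)])
    (fun l u hlu hlt hu x hx y hy => by
      have hm := hlu.mirror hanti hω
      rw [hG ⟨(hbd l hlu.left).1.le.trans hx.1.le, hx.2.le.trans (hbd u hlu.right).2.le⟩,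
        hG ⟨(hbd _ hm.left).1.le.trans hy.1.le, hy.2.le.trans (hbd _ hm.right).2.le⟩]
      exact hsign l hlu.left u hlu.right hlt hu hlu.gap x hx y hy)
  refine ⟨r, hr, fun y => ?_, fun x hx => by rw [hrr, hG hx], hrβ⟩
  exact ⟨r (G.symm y), by rw [hrr, G.apply_symm_apply]⟩

/-- Gives continuity of the root for free, since `r ∘ r` being onto makes `r` onto. -/
theorem _root_.StrictAnti.continuous_of_surjective {r : ℝ → ℝ} (hr : StrictAnti r)
    (hs : Function.Surjective r) : Continuous r := by
  have : Continuous fun x => -r x := by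
    refine Monotone.continuous_of_surjective (fun x y hxy => neg_le_neg (hr.antitone hxy)) fun y => ?_
    obtain ⟨x, hx⟩ := hs (-y)
    exact ⟨x, by simp [hx]⟩
  convert this.neg using 1
  ext x
  simp

theorem _root_.StrictAnti.exists_inverse {r : ℝ → ℝ} (hr : StrictAnti r)
    (hs : Function.Surjective r) : ∃ s : ℝ → ℝ, StrictAnti s ∧ Continuous s ∧
      (∀ x, s (r x) = x) ∧ ∀ y, r (s y) = y := by
  obtain ⟨s, hs'⟩ := hs.hasRightInverse
  have hsr (x) : s (r x) = x := hr.injective (hs' (r x))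
  have hanti : StrictAnti s := fun x y hxy => by rwa [← hr.lt_iff_gt, hs' x, hs' y]
  exact ⟨s, hanti, hanti.continuous_of_surjective fun x => ⟨r x, hsr x⟩, hsr, hs'⟩

theorem exists_strictAnti_extension {α β : ℝ} {F : ℝ → ℝ} (h : α ≤ β)
    (hm : StrictAntiOn F (Icc α β)) (hc : ContinuousOn F (Icc α β)) :
    ∃ Q : ℝ → ℝ, StrictAnti Q ∧ Function.Surjective Q ∧ EqOn Q F (Icc α β) := by
  obtain ⟨G, hG, -⟩ := exists_orderIso_extension h (F := fun x => -F x)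
    (fun x hx y hy hxy => neg_lt_neg (hm hx hy hxy)) hc.neg
  refine ⟨fun x => -G x, fun x y hxy => neg_lt_neg (G.strictMono hxy), fun y => ?_,
    fun x hx => by simp [hG hx]⟩
  exact ⟨G.symm (-y), by simp⟩

/-! ### Extending the root to the whole interval -/

/-- Extension of a decreasing square root from the characteristic interval `[a, p]` to `[a, b]`. -/
theorem exists_root_extension {a b p m : ℝ} {F r : ℝ → ℝ} (hap : a < p) (hpm : p < m) (hmb : m ≤ b)
    (hFc : ContinuousOn F (Icc a b)) (hFm : MapsTo F (Icc a b) (Icc a p))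
    (hanti : StrictAntiOn F (Icc p m)) (hma : F m = a)
    (hr : StrictAnti r) (hrs : Function.Surjective r) (hrr : ∀ x ∈ Icc a p, r (r x) = F x)
    (hrp : r p = a) :
    ∃ f ψ : ℝ → ℝ, ContinuousOn f (Icc a b) ∧ MapsTo f (Icc a b) (Icc a b) ∧
      (∀ x ∈ Icc a b, f (f x) = F x) ∧ StrictAntiOn f (Icc a p) ∧ StrictMonoOn f (Icc p m) ∧
      StrictMono ψ ∧ EqOn f (ψ ∘ F) (Icc m b) := by
  obtain ⟨s, hs, hsc, hsr, hrs'⟩ := hr.exists_inverse hrs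
  obtain ⟨Q, hQ, hQs, hQF⟩ := exists_strictAnti_extension hpm.le hanti
    (hFc.mono (Icc_subset_Icc hap.le hmb))
  obtain ⟨P, hP, hPc, hPQ, hQP⟩ := hQ.exists_inverse hQs
  have hrc := hr.continuous_of_surjective hrs
  have hp : p ∈ Icc a b := ⟨hap.le, hpm.le.trans hmb⟩
  have hra : r a = F p := by rw [← hrp, hrr p ⟨hap.le, le_rfl⟩]
  have hsa : s a = p := by rw [← hrp, hsr]
  have hsF : s (F p) = a := by rw [← hra, hsr]
  have hPF : P (F p) = p := by rw [← hQF ⟨le_rfl, hpm.le⟩, hPQ]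
  have hPa : P a = m := by rw [← hma, ← hQF ⟨hpm.le, le_rfl⟩, hPQ]
  -- Each formula solves `f (f x) = F x` once the target is chosen: the first two pieces land in
  -- `[a, p]`, where `f = r`; the third lands in `[p, m]`, where `f = s ∘ F`.
  set f : ℝ → ℝ := fun x => if x ≤ p then r x else if x ≤ m then s (F x) else P (r (F x)) with hf
  have hf1 : EqOn f r (Icc a p) := fun x hx => if_pos hx.2
  have hf2 : EqOn f (fun x => s (F x)) (Icc p m) := fun x hx => by
    rcases hx.1.eq_or_lt with rfl | h
    · simp [hf, hrp, hsF]
    · simp [hf, h.not_ge, hx.2]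
  have hf3 : EqOn f (fun x => P (r (F x))) (Icc m b) := fun x hx => by
    rcases hx.1.eq_or_lt with rfl | h
    · simp [hf, hpm.not_ge, hma, hsa, hra, hPF]
    · simp [hf, h.not_ge, (hpm.trans h).not_ge]
  have hm1 : MapsTo f (Icc a p) (Icc a p) := fun x hx => by
    rw [hf1 hx]
    exact ⟨hrp ▸ hr.antitone hx.2, (hra ▸ hr.antitone hx.1 : r x ≤ F p).trans (hFm hp).2⟩
  have hm2 : MapsTo f (Icc p m) (Icc a p) := fun x hx => by
    rw [hf2 hx]
    have h1 : F x ≤ F p := hanti.antitoneOn (left_mem_Icc.2 hpm.le) hx hx.1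
    have h2 : a ≤ F x := hma ▸ hanti.antitoneOn hx (right_mem_Icc.2 hpm.le) hx.2
    exact ⟨hsF ▸ hs.antitone h1, hsa ▸ hs.antitone h2⟩
  have hm3 : MapsTo f (Icc m b) (Icc p m) := fun x hx => by
    rw [hf3 hx]
    have h := hFm (show x ∈ Icc a b from ⟨by linarith [hx.1], hx.2⟩)
    have h1 : r (F x) ≤ F p := hra ▸ hr.antitone h.1
    have h2 : a ≤ r (F x) := hrp ▸ hr.antitone h.2
    exact ⟨hPF ▸ hP.antitone h1, hPa ▸ hP.antitone h2⟩
  have hU : Icc a p ∪ Icc p m ∪ Icc m b = Icc a b := by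
    rw [Icc_union_Icc_eq_Icc hap.le hpm.le, Icc_union_Icc_eq_Icc (hap.trans hpm).le hmb]
  have hc1 : ContinuousOn f (Icc a p) := hrc.continuousOn.congr hf1
  have hc2 : ContinuousOn f (Icc p m) :=
    (hsc.comp_continuousOn (hFc.mono (Icc_subset_Icc hap.le hmb))).congr hf2
  have hc3 : ContinuousOn f (Icc m b) :=
    ((hPc.comp hrc).comp_continuousOn
      (hFc.mono (Icc_subset_Icc_left (hap.trans hpm).le))).congr hf3
  refine ⟨f, P ∘ r, ?_, ?_, ?_, ?_, ?_, hP.comp hr, hf3⟩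
  · rw [← hU]
    exact (hc1.union_of_isClosed hc2 isClosed_Icc isClosed_Icc).union_of_isClosed hc3
      (isClosed_Icc.union isClosed_Icc) isClosed_Icc
  · intro x hx
    rw [← hU] at hx
    rcases hx with (hx | hx) | hx
    · exact Icc_subset_Icc_right hp.2 (hm1 hx)
    · exact Icc_subset_Icc_right hp.2 (hm2 hx)
    · exact Icc_subset_Icc hap.le hmb (hm3 hx)
  · intro x hx
    rw [← hU] at hx
    rcases hx with (hx | hx) | hx
    · rw [hf1 (hm1 hx), hf1 hx, hrr x hx]
    · rw [hf1 (hm2 hx), hf2 hx, hrs']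
    · rw [hf2 (hm3 hx)]
      dsimp only
      rw [← hQF (hm3 hx), hf3 hx, hQP, hsr]
  · exact (hr.strictAntiOn _).congr hf1.symm
  · refine StrictMonoOn.congr (fun x hx y hy hxy => ?_) hf2.symm
    exact hs (hanti hx hy hxy)

/-! ### Forts under composition, and the height -/

/-- `F` is strictly monotone on some neighbourhood of `x`. -/
def IsLocStrict (F : ℝ → ℝ) (x : ℝ) : Prop :=
  ∃ U ∈ 𝓝 x, StrictMonoOn F U ∨ StrictAntiOn F U

section IsLocStrict

variable {F f ψ : ℝ → ℝ} {a b α β x : ℝ}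

theorem mem_forts_iff : x ∈ forts a b F ↔ x ∈ Ioo a b ∧ ¬ IsLocStrict F x := Iff.rfl

theorem isLocStrict_of_strictMonoOn (h : StrictMonoOn F (Icc α β)) (hx : x ∈ Ioo α β) :
    IsLocStrict F x :=
  ⟨_, Icc_mem_nhds hx.1 hx.2, .inl h⟩

theorem isLocStrict_of_strictAntiOn (h : StrictAntiOn F (Icc α β)) (hx : x ∈ Ioo α β) :
    IsLocStrict F x :=
  ⟨_, Icc_mem_nhds hx.1 hx.2, .inr h⟩

theorem IsLocStrict.not_isLocalExtr (h : IsLocStrict F x) : ¬ IsLocalExtr F x := by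
  obtain ⟨U, hU, hF⟩ := h
  intro he
  have hxU := mem_of_mem_nhds hU
  have hl {p : ℝ → Prop} (hp : ∀ᶠ y in 𝓝 x, p y) : ∃ y ∈ U, y < x ∧ p y := by
    obtain ⟨y, ⟨h1, h2⟩, h3⟩ := ((hp.and hU).filter_mono nhdsWithin_le_nhds |>.and
      (self_mem_nhdsWithin (a := x) (s := Iio x))).exists
    exact ⟨y, h2, h3, h1⟩
  have hr {p : ℝ → Prop} (hp : ∀ᶠ y in 𝓝 x, p y) : ∃ y ∈ U, x < y ∧ p y := by
    obtain ⟨y, ⟨h1, h2⟩, h3⟩ := ((hp.and hU).filter_mono nhdsWithin_le_nhds |>.and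
      (self_mem_nhdsWithin (a := x) (s := Ioi x))).exists
    exact ⟨y, h2, h3, h1⟩
  rcases he with he | he <;> rcases hF with hF | hF
  · obtain ⟨y, hy, hyx, h⟩ := hl he; exact (hF hy hxU hyx).not_ge h
  · obtain ⟨y, hy, hyx, h⟩ := hr he; exact (hF hxU hy hyx).not_ge h
  · obtain ⟨y, hy, hyx, h⟩ := hr he; exact (hF hxU hy hyx).not_ge h
  · obtain ⟨y, hy, hyx, h⟩ := hl he; exact (hF hy hxU hyx).not_ge h

theorem not_isLocStrict_of_anti_of_mono (hα : α < x) (hβ : x < β) (h1 : StrictAntiOn F (Icc α x))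
    (h2 : StrictMonoOn F (Icc x β)) : ¬ IsLocStrict F x := fun h =>
  h.not_isLocalExtr <| .inl <| by
    filter_upwards [Icc_mem_nhds hα hβ] with y hy
    rcases le_total y x with h | h
    · exact h1.antitoneOn ⟨hy.1, h⟩ ⟨hα.le, le_rfl⟩ h
    · exact h2.monotoneOn ⟨le_rfl, hβ.le⟩ ⟨h, hy.2⟩ h

/-- A strictly monotone outer map preserves or reverses every comparison of values, so strict
monotonicity passes both ways. -/
theorem isLocStrict_comp_iff {T V : Set ℝ} (hψ : StrictMonoOn ψ T ∨ StrictAntiOn ψ T)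
    (hV : V ∈ 𝓝 x) (hF : MapsTo F V T) (hf : EqOn f (ψ ∘ F) V) :
    IsLocStrict f x ↔ IsLocStrict F x := by
  constructor
  · rintro ⟨U, hU, h⟩
    refine ⟨U ∩ V, inter_mem hU hV, ?_⟩
    rcases hψ with hψ | hψ <;> rcases h with h | h
    · refine .inl fun y hy z hz hyz => ?_
      have := h hy.1 hz.1 hyz
      rwa [hf hy.2, hf hz.2, Function.comp, Function.comp, hψ.lt_iff_lt (hF hy.2) (hF hz.2)] at this
    · refine .inr fun y hy z hz hyz => ?_
      have := h hy.1 hz.1 hyz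
      rwa [hf hy.2, hf hz.2, Function.comp, Function.comp, hψ.lt_iff_lt (hF hz.2) (hF hy.2)] at this
    · refine .inr fun y hy z hz hyz => ?_
      have := h hy.1 hz.1 hyz
      rwa [hf hy.2, hf hz.2, Function.comp, Function.comp, hψ.lt_iff_gt (hF hy.2) (hF hz.2)] at this
    · refine .inl fun y hy z hz hyz => ?_
      have := h hy.1 hz.1 hyz
      rwa [hf hy.2, hf hz.2, Function.comp, Function.comp, hψ.lt_iff_gt (hF hz.2) (hF hy.2)] at this
  · rintro ⟨U, hU, h⟩
    refine ⟨U ∩ V, inter_mem hU hV, ?_⟩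
    rcases hψ with hψ | hψ <;> rcases h with h | h
    · refine .inl fun y hy z hz hyz => ?_
      rw [hf hy.2, hf hz.2]
      exact hψ (hF hy.2) (hF hz.2) (h hy.1 hz.1 hyz)
    · refine .inr fun y hy z hz hyz => ?_
      rw [hf hy.2, hf hz.2]
      exact hψ (hF hz.2) (hF hy.2) (h hy.1 hz.1 hyz)
    · refine .inr fun y hy z hz hyz => ?_
      rw [hf hy.2, hf hz.2]
      exact hψ (hF hy.2) (hF hz.2) (h hy.1 hz.1 hyz)
    · refine .inl fun y hy z hz hyz => ?_
      rw [hf hy.2, hf hz.2]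
      exact hψ (hF hz.2) (hF hy.2) (h hy.1 hz.1 hyz)

theorem forts_comp {T : Set ℝ} (hψ : StrictMonoOn ψ T ∨ StrictAntiOn ψ T)
    (hF : MapsTo F (Icc a b) T) (hf : EqOn f (ψ ∘ F) (Icc a b)) : forts a b f = forts a b F := by
  ext x
  rw [mem_forts_iff, mem_forts_iff]
  refine and_congr_right fun hx => not_congr ?_
  exact isLocStrict_comp_iff hψ (Icc_mem_nhds hx.1 hx.2) hF hf

theorem forts_congr (hf : EqOn f F (Icc a b)) : forts a b f = forts a b F :=
  forts_comp (ψ := id) (.inl (strictMono_id.strictMonoOn univ)) (mapsTo_univ ..) hf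

/-- A continuous function is strictly monotone between consecutive forts. -/
theorem strictMonoOn_or_strictAntiOn_of_forts (ha : a ≤ α) (hαβ : α ≤ β) (hb : β ≤ b)
    (hF : ContinuousOn F (Icc a b)) (h : ∀ x ∈ Ioo α β, x ∉ forts a b F) :
    StrictMonoOn F (Icc α β) ∨ StrictAntiOn F (Icc α β) := by
  have hF' := hF.mono (Icc_subset_Icc ha hb)
  refine hF'.strictMonoOn_of_injOn_Icc' hαβ ?_
  have key {x y} (hx : x ∈ Icc α β) (hy : y ∈ Icc α β) (hxy : x < y) : F x ≠ F y := fun he => by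
    -- As in Rolle's theorem, equal values force an interior local extremum, which is a fort.
    obtain ⟨z, hz, hext⟩ := exists_isLocalExtr_Ioo hxy (hF'.mono (Icc_subset_Icc hx.1 hy.2)) he
    have hz' : z ∈ Ioo α β := Ioo_subset_Ioo hx.1 hy.2 hz
    refine h z hz' ⟨Ioo_subset_Ioo ha hb hz', fun hs => ?_⟩
    exact IsLocStrict.not_isLocalExtr hs hext
  intro x hx y hy he
  by_contra hne
  rcases lt_or_gt_of_ne hne with hlt | hlt
  · exact key hx hy hlt he
  · exact key hy hx hlt he.symm

theorem _root_.StrictMonoOn.Icc_union {y : ℝ} (h1 : StrictMonoOn F (Icc α x))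
    (h2 : StrictMonoOn F (Icc x y)) (hα : α ≤ x) (hy : x ≤ y) : StrictMonoOn F (Icc α y) := by
  rw [← Icc_union_Icc_eq_Icc hα hy]
  exact h1.union h2 (isGreatest_Icc hα) (isLeast_Icc hy)

theorem _root_.StrictAntiOn.Icc_union {y : ℝ} (h1 : StrictAntiOn F (Icc α x))
    (h2 : StrictAntiOn F (Icc x y)) (hα : α ≤ x) (hy : x ≤ y) : StrictAntiOn F (Icc α y) := by
  rw [← Icc_union_Icc_eq_Icc hα hy]
  exact h1.union h2 (isGreatest_Icc hα) (isLeast_Icc hy)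

theorem height_eq_two {f : ℝ → ℝ} (h0 : numForts a b f^[0] ≠ numForts a b f^[1])
    (h1 : numForts a b f^[1] ≠ numForts a b f^[2])
    (h2 : numForts a b f^[2] = numForts a b f^[3]) : height a b f = 2 := by
  refine le_antisymm (sInf_le ⟨2, h2, rfl⟩) (le_sInf ?_)
  rintro _ ⟨i, hi, rfl⟩
  have : 2 ≤ i := by
    by_contra! hc
    interval_cases i
    · exact h0 hi
    · exact h1 hi
  exact Nat.cast_le.2 this

end IsLocStrict

/-! ### Assembly and counting of forts -/

/-- A decreasing square root of `F` on the characteristic interval extends to one of `F`, whose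
forts are those of `F` except `c 2`. -/
theorem exists_isIterativeRoot_two {a b : ℝ} {F : ℝ → ℝ} {v : ℕ} {c : ℕ → ℝ}
    (hF : IsPM a b F)
    (hc : IsFortEnum a b F v c)
    (hv : 2 ≤ v)
    (hK : IsCharInterval a b F (c 0) (c 1))
    (hKplus : StrictMonoOn F (Icc (c 0) (c 1)))
    (hrev : IsReversingCorrespondence (c 0) (c 1) F)
    (h0 : c 0 < F (c 0))
    (h1 : F (c 1) < c 1)
    (h2 : F (c 2) = c 0) :
    ∃ f : ℝ → ℝ,
      IsPM a b f ∧
      IsIterativeRoot a b 2 F f ∧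
      height a b f = 2 ∧
      StrictAntiOn f (Icc (c 0) (c 1)) := by
  have hmono {i j : ℕ} (hij : i < j) (hj : j ≤ v + 1) : c i < c j :=
    hc.strictMonoOn (Set.mem_Iic.2 (hij.le.trans hj)) (Set.mem_Iic.2 hj) hij
  have hle {i : ℕ} (hi : i ≤ v + 1) : a ≤ c i ∧ c i ≤ b := by
    rw [← hc.left, ← hc.right]
    exact ⟨hc.strictMonoOn.monotoneOn (Set.mem_Iic.2 (by omega)) (Set.mem_Iic.2 hi) (by omega),
      hc.strictMonoOn.monotoneOn (Set.mem_Iic.2 hi) (Set.mem_Iic.2 le_rfl) hi⟩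
  have hlap (i : ℕ) (hi : i ≤ v) :
      StrictMonoOn F (Set.Icc (c i) (c (i + 1))) ∨ StrictAntiOn F (Set.Icc (c i) (c (i + 1))) := by
    refine strictMonoOn_or_strictAntiOn_of_forts (hle (by omega)).1 (hmono (by omega) (by omega)).le
      (hle (by omega)).2 hF.continuousOn ?_
    rintro x ⟨hx1, hx2⟩ hx
    rw [hc.forts_eq] at hx
    obtain ⟨j, ⟨hj1, hj2⟩, rfl⟩ := hx
    rw [hc.strictMonoOn.lt_iff_lt (Set.mem_Iic.2 (by omega)) (Set.mem_Iic.2 (by omega))] at hx1 hx2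
    omega
  have hfort {i : ℕ} (h1 : 1 ≤ i) (hi : i ≤ v) : c i ∈ forts a b F :=
    hc.forts_eq.ge ⟨i, ⟨h1, hi⟩, rfl⟩
  have h01 : c 0 < c 1 := hmono one_pos (by omega)
  have h12 : c 1 < c 2 := hmono one_lt_two (by omega)
  have h23 : c 2 < c 3 := hmono (by omega) (by omega)
  have h3b : c 3 ≤ b := (hle (by omega)).2
  -- Monotonicity must switch at each fort, otherwise two laps would merge into one.
  have hanti : StrictAntiOn F (Set.Icc (c 1) (c 2)) := (hlap 1 (by omega)).resolve_left fun h =>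
    (hfort le_rfl (by omega)).2
      (isLocStrict_of_strictMonoOn (hKplus.Icc_union h h01.le h12.le) ⟨h01, h12⟩)
  have hinc : StrictMonoOn F (Set.Icc (c 2) (c 3)) := (hlap 2 hv).resolve_right fun h =>
    (hfort one_le_two hv).2
      (isLocStrict_of_strictAntiOn (hanti.Icc_union h h12.le h23.le) ⟨h12, h23⟩)
  have hFK : Set.MapsTo F (Set.Icc a b) (Set.Icc (c 0) (c 1)) :=
    fun x hx => hK.range_subset (Set.mem_image_of_mem F hx)
  obtain ⟨r, hr, hrs, hrr, hr1⟩ := hrev.exists_strictAnti_sqrt h0 h1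
  obtain rfl := hc.left
  obtain ⟨f, ψ, hfc, hfm, hff, hfanti, hfinc, hψ, hfψ⟩ := exists_root_extension h01 h12
    (h23.le.trans h3b) hF.continuousOn hFK hanti h2 hr hrs hrr hr1
  have hfinc3 : StrictMonoOn f (Set.Icc (c 1) (c 3)) := by
    refine hfinc.Icc_union (fun x hx y hy hxy => ?_) h12.le h23.le
    rw [hfψ ⟨hx.1, hx.2.trans h3b⟩, hfψ ⟨hy.1, hy.2.trans h3b⟩]
    exact hψ (hinc hx hy hxy)
  have hf1 : c 1 ∈ forts (c 0) b f := ⟨⟨h01, by linarith⟩,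
    not_isLocStrict_of_anti_of_mono h01 (h12.trans h23) hfanti hfinc3⟩
  have hforts : forts (c 0) b f = forts (c 0) b F \ {c 2} := by
    ext x
    rw [Set.mem_sdiff, Set.mem_singleton_iff]
    rcases lt_trichotomy x (c 1) with hx | rfl | hx
    · refine iff_of_false (fun h => h.2 ?_) (fun h => h.1.2 ?_)
      · exact isLocStrict_of_strictAntiOn hfanti ⟨h.1.1, hx⟩
      · exact isLocStrict_of_strictMonoOn hKplus ⟨h.1.1.1, hx⟩
    · exact iff_of_true hf1 ⟨hfort le_rfl (by omega), h12.ne⟩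
    rcases lt_trichotomy x (c 2) with hx' | rfl | hx'
    · refine iff_of_false (fun h => h.2 ?_) (fun h => h.1.2 ?_)
      · exact isLocStrict_of_strictMonoOn hfinc ⟨hx, hx'⟩
      · exact isLocStrict_of_strictAntiOn hanti ⟨hx, hx'⟩
    · exact iff_of_false (fun h => h.2 (isLocStrict_of_strictMonoOn hfinc3 ⟨h12, h23⟩))
        fun h => h.2 rfl
    · rw [mem_forts_iff, mem_forts_iff, and_iff_left hx'.ne']
      refine and_congr_right fun hxI => not_congr ?_
      exact isLocStrict_comp_iff (.inl (hψ.strictMonoOn Set.univ)) (Icc_mem_nhds hx' hxI.2)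
        (Set.mapsTo_univ ..) hfψ
  have hfin : (forts (c 0) b f).Finite := hforts ▸ hF.finite_forts.sdiff
  have hiter : Set.EqOn f^[2] F (Set.Icc (c 0) b) := hff
  have hN2 : numForts (c 0) b f^[2] = numForts (c 0) b F := congrArg Set.encard (forts_congr hiter)
  refine ⟨f, ⟨hfc, hfm, hfin⟩, ⟨hfc, hfm, hiter⟩, height_eq_two ?_ ?_ ?_, hfanti⟩
  · have hid : numForts (c 0) b f^[0] = 0 := by
      rw [numForts, Set.encard_eq_zero, Set.eq_empty_iff_forall_notMem]
      exact fun x hx => hx.2 ⟨Set.univ, Filter.univ_mem, .inl (strictMono_id.strictMonoOn _)⟩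
    rw [hid]
    exact (Set.encard_pos.2 ⟨_, hf1⟩).ne
  -- Equality would contradict finiteness, since `f` has exactly one fort fewer than `F`.
  · rw [hN2]
    intro h
    have := Set.encard_sdiff_singleton_add_one (hfort one_le_two hv)
    rw [← hforts] at this
    have h' : (forts (c 0) b f).encard = (forts (c 0) b F).encard := h
    rw [← h'] at this
    exact ((ENat.lt_add_one_iff hfin.encard_lt_top.ne).2 le_rfl).ne' this
  · rw [hN2]
    -- `f³ = f ∘ F`, and `f` is strictly decreasing on the characteristic interval, which contains
    -- the range of `F`.
    refine congrArg Set.encard (forts_comp (ψ := f) (.inr hfanti) hFK fun x hx => ?_).symm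
    exact congrArg f (hff x hx)

end PMFun

theorem theorem2p3 (a b : ℝ) (F : ℝ → ℝ) (v : ℕ) (c : ℕ → ℝ)
    (hF : PMFun.IsPM a b F)
    (hc : PMFun.IsFortEnum a b F v c)
    (hv : 2 ≤ v)
    (hH : PMFun.height a b F = 1)
    (hK : PMFun.IsCharInterval a b F (c 0) (c 1))
    (hKplus : StrictMonoOn F (Set.Icc (c 0) (c 1)))
    (hrev : PMFun.IsReversingCorrespondence (c 0) (c 1) F)
    (h0 : c 0 < F (c 0))
    (h1 : F (c 1) < c 1)
    (h2 : F (c 2) = c 0) :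
    ∃ f : ℝ → ℝ,
      PMFun.IsPM a b f ∧
      PMFun.IsIterativeRoot a b 2 F f ∧
      PMFun.height a b f = 2 ∧
      StrictAntiOn f (Set.Icc (c 0) (c 1)) := by
  exact PMFun.exists_isIterativeRoot_two hF hc hv hK hKplus hrev h0 h1 h2
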